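/- Let $\mathbb D$ be the open unit disk. For a harmonic function $f$ in $\mathbb D$ with Jacobian $J_f$ put $$\beta(f)=\sup_{z\in\mathbb D}(1-|z|^2)\sqrt{|J_f(z)|},$$ and let $\mathcal B_H$ be the class of all harmonic $f$ in $\mathbb D$ with $\beta(f)<\infty$. A harmonic function $f=h+\overline g$ ($h,g$ analytic in $\mathbb D$; then $J_f=|h'|^2-|g'|^2$) is called sense-preserving if $J_f>0$ in $\mathbb D$, and it has dilatation $\omega$ if $g'=\omega h'$ in $\mathbb D$. Let $S_H$ be the class of univalent sense-preserving harmonic functions $f=h+\overline g$ in $\mathbb D$ with $h(0)=0$, $h'(0)=1$, $g(0)=0$. **Theorem.** Let $F=H+\overline{G}$ (with $H,G$ analytic in $\mathbb D$) be univalent and sense-preserving in $\mathbb D$. Then $\log H'$ has analytic branches in $\mathbb D$; let $h=\log H'$ be any of them. 1. For every analytic $\omega:\mathbb D\to\mathbb D$ there are harmonic functions $f=h+\overline g$, with $g$ analytic in $\mathbb D$, that have dilatation $\omega$, and every such $f$ belongs to $\mathcal B_H$. In fact $\beta(f)<101$. 2. For every $\alpha\in\mathbb D$ the function $$T_\alpha(z)=\frac{F\left(\frac{\alpha+z}{1+\overline\alpha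 z}\right)-F(\alpha)}{(1-|\alpha|^2)H'(\alpha)},\qquad z\in\mathbb D,$$ belongs to $S_H$, and if $a_2(\alpha)$ denotes the coefficient of $z^2$ in the Taylor expansion at $0$ of its analytic part, then $$(1-|\alpha|^2)\,|h'(\alpha)|=2\,|a_2(\alpha)+\overline\alpha|<101 .$$ -/

import Mathlib

open scoped ComplexConjugate

namespace HarmonicBloch

/-- The open unit disk in `ℂ`. -/
def disk : Set ℂ := Metric.ball 0 1

/-- `f = h + conj g` on the disk, with `h` and `g` analytic there. -/
structure IsCanonicalDecomposition (f h g : ℂ → ℂ) : Prop where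
  analytic_left : DifferentiableOn ℂ h disk
  analytic_right : DifferentiableOn ℂ g disk
  eqOn : ∀ z ∈ disk, f z = h z + conj (g z)

/-- The Jacobian determinant of `f`, seen as a map of the real plane. -/
noncomputable def jacobian (f : ℂ → ℂ) (z : ℂ) : ℝ := (fderiv ℝ f z).det

/-- `f` is univalent (injective) in the disk. -/
def Univalent (f : ℂ → ℂ) : Prop := Set.InjOn f disk

/-- `f` is sense-preserving in the disk: its Jacobian is positive. -/
def SensePreserving (f : ℂ → ℂ) : Prop := ∀ z ∈ disk, 0 < jacobian f z

/-- The supremum over the disk of `(1 - |z|²) √|J_f(z)|`, as an extended nonnegative real. -/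
noncomputable def beta (f : ℂ → ℂ) : ENNReal :=
  ⨆ z ∈ disk, ENNReal.ofReal ((1 - ‖z‖ ^ 2) * √|jacobian f z|)

/-- The class of harmonic Bloch-type functions in the disk. -/
def IsBlochType (f : ℂ → ℂ) : Prop :=
  InnerProductSpace.HarmonicOnNhd f disk ∧ beta f < ⊤

/-- `ω` is an analytic self-map of the disk. -/
def IsAnalyticSelfMap (ω : ℂ → ℂ) : Prop :=
  DifferentiableOn ℂ ω disk ∧ Set.MapsTo ω disk disk

/-- The harmonic function `h + conj g` has dilatation `ω = g' / h'`. The equation is cleared of its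
denominator, so that it also makes sense at the zeros of `h'`. -/
def HasDilatation (h g ω : ℂ → ℂ) : Prop :=
  ∀ z ∈ disk, deriv g z = ω z * deriv h z

/-- `h` is an analytic branch of `log H'` in the disk. -/
def IsLogOfDeriv (h H : ℂ → ℂ) : Prop :=
  DifferentiableOn ℂ h disk ∧ ∀ z ∈ disk, Complex.exp (h z) = deriv H z

/-- The `n`-th Taylor coefficient at the origin. -/
noncomputable def taylorCoeff (h : ℂ → ℂ) (n : ℕ) : ℂ := iteratedDeriv n h 0 / (n.factorial : ℂ)

/-- `f` belongs to the class `S_H`, with analytic part `h(z) = z + a₂ z² + …` and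
co-analytic part `g(z) = b₁ z + b₂ z² + …`. The functions `h` and `g` are uniquely determined
by `f` in the disk. -/
structure MemSHWithParts (f h g : ℂ → ℂ) : Prop where
  decomposition : IsCanonicalDecomposition f h g
  univalent : Univalent f
  sensePreserving : SensePreserving f
  coeff_zero : taylorCoeff h 0 = 0
  coeff_one : taylorCoeff h 1 = 1
  coanalytic_coeff_zero : taylorCoeff g 0 = 0

/-- The disk automorphism `z ↦ (α + z) / (1 + conj α * z)`. -/
noncomputable def diskAut (α z : ℂ) : ℂ := (α + z) / (1 + conj α * z)

/-- The normalized translate of `F`, a harmonic function with analytic part `H`, by the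
disk automorphism `diskAut α`. -/
noncomputable def normalizedTranslate (F H : ℂ → ℂ) (α z : ℂ) : ℂ :=
  (F (diskAut α z) - F α) / ((1 - (‖α‖ : ℂ) ^ 2) * deriv H α)

end HarmonicBloch

/-! Everything rests on the bound `(1 - |z|²)|h'(z)| ≤ 100.9` for `h = log H'` (`bloch_bound`). It
is proved by contradiction, by rescaling at an extremal point. Dilating by `r < 1` makes the
supremum `M` of the Bloch quantity attained, and a disk automorphism moves the maximum point to the
origin. The transported derivative `u` of `h` satisfies `|u| ≤ M/(1 - |z|²)` with equality at `0`;
by Borel–Carathéodory it is then almost constant at distance of order `1/M`. So the logarithm of the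
new analytic derivative is almost affine there, and at that scale the analytic part looks like
`exp`, while Schwarz–Pick makes the dilatation almost equal to a constant `b`.

An injective real-linear map removes `b`, leaving a small perturbation of `exp` on a disk of radius
`3.6 > π`. Since `exp(iπ) = exp(-iπ)`, a contraction argument finds two opposite points with equal
values (`exists_ne_zero_eq_neg`), contradicting univalence (`not_injOn_of_extremal`).

Given the bound, the estimate of `beta` follows from `√|J_f| ≤ |h'|`, and the coefficient identity
from a logarithmic derivative at `0`. -/

namespace HarmonicBloch

/-! ### Perturbations of the exponential are not injective. -/

/-- On the part of a ball lying in a vertical strip, a perturbation of the exponential whose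
derivatives are small relative to the exponential is Lipschitz up to the exponential. -/
lemma norm_sub_exp_sub_le {E W E' W' : ℂ → ℂ} {b c : ℂ} {R l₁ l₂ t : ℝ}
    (hb : ‖b‖ ≤ 1) (hc : ‖c‖ ≤ 1) (hl₁ : 0 ≤ l₁) (hl₂ : 0 ≤ l₂)
    (hE : ∀ w ∈ Metric.ball (0 : ℂ) R, HasDerivAt E (E' w) w)
    (hW : ∀ w ∈ Metric.ball (0 : ℂ) R, HasDerivAt W (W' w) w)
    (hE' : ∀ w ∈ Metric.ball (0 : ℂ) R, ‖E' w - Complex.exp w‖ ≤ l₁ * ‖Complex.exp w‖)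
    (hW' : ∀ w ∈ Metric.ball (0 : ℂ) R, ‖W' w‖ ≤ l₂ * ‖Complex.exp w‖)
    {x y : ℂ} (hx : x ∈ Metric.ball (0 : ℂ) R) (hxt : x.re ≤ t)
    (hy : y ∈ Metric.ball (0 : ℂ) R) (hyt : y.re ≤ t) :
    ‖(E x - conj b * W x + c * conj (W x) - Complex.exp x)
        - (E y - conj b * W y + c * conj (W y) - Complex.exp y)‖
      ≤ (l₁ + 2 * l₂) * Real.exp t * ‖x - y‖ := by
  -- The half-plane keeps the domain convex, as the mean value inequality needs, and bounds `|exp|`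
  -- by `e^t`, much better than `e^R` when `t` is small.
  have hconv : Convex ℝ (Metric.ball (0 : ℂ) R ∩ {w | w.re ≤ t}) :=
    (convex_ball _ _).inter (convex_halfSpace_re_le t)
  have hexp : ∀ w : ℂ, w.re ≤ t → ‖Complex.exp w‖ ≤ Real.exp t := fun w hw => by
    rw [Complex.norm_exp]; exact Real.exp_le_exp.2 hw
  have h1 : ‖(E x - Complex.exp x) - (E y - Complex.exp y)‖ ≤ l₁ * Real.exp t * ‖x - y‖ :=
    hconv.norm_image_sub_le_of_norm_hasDerivWithin_le (f := fun w => E w - Complex.exp w)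
      (fun w hw => ((hE w hw.1).sub (Complex.hasDerivAt_exp w)).hasDerivWithinAt)
      (fun w hw => (hE' w hw.1).trans (mul_le_mul_of_nonneg_left (hexp w hw.2) hl₁))
      ⟨hy, hyt⟩ ⟨hx, hxt⟩
  have h2 : ‖W x - W y‖ ≤ l₂ * Real.exp t * ‖x - y‖ :=
    hconv.norm_image_sub_le_of_norm_hasDerivWithin_le
      (fun w hw => (hW w hw.1).hasDerivWithinAt)
      (fun w hw => (hW' w hw.1).trans (mul_le_mul_of_nonneg_left (hexp w hw.2) hl₂))
      ⟨hy, hyt⟩ ⟨hx, hxt⟩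
  have h3 : ‖conj b * (W x - W y)‖ ≤ ‖W x - W y‖ := by
    rw [norm_mul, RCLike.norm_conj]
    exact mul_le_of_le_one_left (norm_nonneg _) hb
  have h4 : ‖c * conj (W x - W y)‖ ≤ ‖W x - W y‖ := by
    rw [norm_mul, RCLike.norm_conj]
    exact mul_le_of_le_one_left (norm_nonneg _) hc
  have e : (E x - conj b * W x + c * conj (W x) - Complex.exp x)
        - (E y - conj b * W y + c * conj (W y) - Complex.exp y)
      = ((E x - Complex.exp x) - (E y - Complex.exp y)) - conj b * (W x - W y)
        + c * conj (W x - W y) := by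
    rw [map_sub]; ring
  rw [e]
  refine (norm_add_le _ _).trans ?_
  have := norm_sub_le ((E x - Complex.exp x) - (E y - Complex.exp y)) (conj b * (W x - W y))
  linarith

/-- The derivative `1 - cosh w` is minus the average of the second-order remainders of `exp` at `w`
and `-w`, each at most `e^r - 1 - r`. This provides the contraction near `iπ`. -/
lemma norm_sub_sinh_sub_le {r : ℝ} {x y : ℂ} (hx : ‖x‖ ≤ r) (hy : ‖y‖ ≤ r) :
    ‖(x - Complex.sinh x) - (y - Complex.sinh y)‖ ≤ (Real.exp r - 1 - r) * ‖x - y‖ := by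
  have key : ∀ z : ℂ, ‖z‖ ≤ r → ‖Complex.exp z - 1 - z‖ ≤ Real.exp r - 1 - r := by
    intro z hz
    have h := Complex.norm_exp_sub_sum_le_exp_norm_sub_sum z 2
    simp only [Finset.sum_range_succ, Finset.sum_range_zero] at h
    norm_num at h
    have hmono : Real.exp ‖z‖ - ‖z‖ ≤ Real.exp r - r := by
      have h1 := Real.add_one_le_exp (r - ‖z‖)
      have h2 : Real.exp r = Real.exp ‖z‖ * Real.exp (r - ‖z‖) := by
        rw [← Real.exp_add]; congr 1; ring
      have h3 := Real.one_le_exp (norm_nonneg z)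
      nlinarith
    rw [sub_sub]
    linarith
  refine (convex_closedBall (0 : ℂ) r).norm_image_sub_le_of_norm_hasDerivWithin_le
    (f := fun z => z - Complex.sinh z)
    (fun w _ => ((hasDerivAt_id w).sub (Complex.hasDerivAt_sinh w)).hasDerivWithinAt) ?_
    (by simpa using hy) (by simpa using hx)
  intro w hw
  rw [mem_closedBall_zero_iff] at hw
  have e : 1 - Complex.cosh w
      = -((Complex.exp w - 1 - w) + (Complex.exp (-w) - 1 - (-w))) / 2 := by
    rw [Complex.cosh]; ring
  rw [e, norm_div, norm_neg, RCLike.norm_ofNat]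
  have h1 := key w hw
  have h2 := key (-w) (by rwa [norm_neg])
  have h3 := norm_add_le (Complex.exp w - 1 - w) (Complex.exp (-w) - 1 - (-w))
  linarith

lemma exp_forty_five_hundredths_le : Real.exp 0.45 ≤ 1.5687 := by
  have := Real.exp_bound' (x := 0.45) (by norm_num) (by norm_num) (n := 5) (by norm_num)
  refine this.trans ?_
  norm_num [Finset.sum_range_succ, Nat.factorial]

/-- A small harmonic perturbation of the exponential takes equal values at two opposite points,
near `± i π`. -/
lemma exists_ne_zero_eq_neg {E W E' W' : ℂ → ℂ} {b c : ℂ} {l₁ l₂ : ℝ}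
    (hb : ‖b‖ ≤ 1) (hc : ‖c‖ ≤ 1) (hl₁ : 0 ≤ l₁) (hl₂ : 0 ≤ l₂) (hl : l₁ + 2 * l₂ ≤ 0.1)
    (hE : ∀ w ∈ Metric.ball (0 : ℂ) 3.6, HasDerivAt E (E' w) w)
    (hW : ∀ w ∈ Metric.ball (0 : ℂ) 3.6, HasDerivAt W (W' w) w)
    (hE' : ∀ w ∈ Metric.ball (0 : ℂ) 3.6, ‖E' w - Complex.exp w‖ ≤ l₁ * ‖Complex.exp w‖)
    (hW' : ∀ w ∈ Metric.ball (0 : ℂ) 3.6, ‖W' w‖ ≤ l₂ * ‖Complex.exp w‖) :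
    ∃ w ∈ Metric.ball (0 : ℂ) 3.6, w ≠ 0 ∧
      E w - conj b * W w + c * conj (W w) = E (-w) - conj b * W (-w) + c * conj (W (-w)) := by
  set q : ℂ → ℂ := fun x => E x - conj b * W x + c * conj (W x) - Complex.exp x with hq
  have hlip : ∀ t : ℝ, ∀ x ∈ Metric.ball (0 : ℂ) 3.6, x.re ≤ t →
      ∀ y ∈ Metric.ball (0 : ℂ) 3.6, y.re ≤ t →
      ‖q x - q y‖ ≤ 0.1 * Real.exp t * ‖x - y‖ := by
    intro t x hx hxt y hy hyt
    refine (norm_sub_exp_sub_le hb hc hl₁ hl₂ hE hW hE' hW' hx hxt hy hyt).trans ?_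
    gcongr
  set a : ℂ := Real.pi * Complex.I with ha
  have hna : ‖a‖ = Real.pi := by simp [ha, abs_of_pos Real.pi_pos]
  have hare : a.re = 0 := by simp [ha]
  have hpi := Real.pi_lt_d4
  have hpi0 := Real.pi_pos
  -- Newton-type map: since `exp(±(a + s)) = -exp(±s)`, the values at `a + s` and `-(a + s)` agree
  -- exactly when `2 sinh s = q(a + s) - q(-(a + s))`, that is, when `K s = s`.
  set K : ℂ → ℂ := fun s => (s - Complex.sinh s) + (q (a + s) - q (-(a + s))) / 2 with hK
  have hmem : ∀ s : ℂ, ‖s‖ ≤ 0.45 → a + s ∈ Metric.ball (0 : ℂ) 3.6 := fun s hs => by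
    rw [mem_ball_zero_iff]
    have := norm_add_le a s
    linarith
  have hmem' : ∀ s : ℂ, ‖s‖ ≤ 0.45 → -(a + s) ∈ Metric.ball (0 : ℂ) 3.6 := fun s hs => by
    have := hmem s hs
    rw [mem_ball_zero_iff] at this ⊢
    rwa [norm_neg]
  have hre : ∀ s : ℂ, ‖s‖ ≤ 0.45 → (a + s).re ≤ 0.45 ∧ (-(a + s)).re ≤ 0.45 := fun s hs => by
    have := abs_le.1 ((Complex.abs_re_le_norm s).trans hs)
    simp only [Complex.neg_re, Complex.add_re, hare]
    constructor <;> linarith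
  have hexp := exp_forty_five_hundredths_le
  -- The constant is `(e^0.45 - 1.45) + 0.1 e^0.45 < 0.276`. The radius `0.45` keeps `π + 0.45 <
  -- 3.6`.
  have hKlip : ∀ x y : ℂ, ‖x‖ ≤ 0.45 → ‖y‖ ≤ 0.45 → ‖K x - K y‖ ≤ 0.276 * ‖x - y‖ := by
    intro x y hx hy
    have h1 := norm_sub_sinh_sub_le hx hy
    have h2 := hlip 0.45 _ (hmem x hx) (hre x hx).1 _ (hmem y hy) (hre y hy).1
    have h3 := hlip 0.45 _ (hmem' x hx) (hre x hx).2 _ (hmem' y hy) (hre y hy).2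
    have e2 : ‖(a + x) - (a + y)‖ = ‖x - y‖ := by congr 1; ring
    have e3 : ‖-(a + x) - -(a + y)‖ = ‖x - y‖ := by rw [← norm_neg]; congr 1; ring
    rw [e2] at h2
    rw [e3] at h3
    have e : K x - K y = ((x - Complex.sinh x) - (y - Complex.sinh y))
        + ((q (a + x) - q (a + y)) - (q (-(a + x)) - q (-(a + y)))) / 2 := by
      simp only [hK]; ring
    rw [e]
    refine (norm_add_le _ _).trans ?_
    rw [norm_div, RCLike.norm_ofNat]
    have h4 := norm_sub_le (q (a + x) - q (a + y)) (q (-(a + x)) - q (-(a + y)))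
    have h5 := norm_nonneg (x - y)
    nlinarith
  -- The points `±iπ` lie on the imaginary axis, so `t = 0` gives `0.1 π`. Then `0.3142 + 0.276 ·
  -- 0.45 < 0.45`, so `K` preserves the disk.
  have hK0 : ‖K 0‖ ≤ 0.3142 := by
    have h := hlip 0 a (by simpa using hmem 0 (by norm_num)) hare.le (-a)
      (by simpa using hmem' 0 (by norm_num)) (by simp [hare])
    have e : K 0 = (q a - q (-a)) / 2 := by simp [hK]
    have e2 : ‖a - -a‖ = 2 * Real.pi := by
      rw [sub_neg_eq_add, ← two_mul, norm_mul, hna, RCLike.norm_ofNat]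
    rw [e2, Real.exp_zero] at h
    rw [e, norm_div, RCLike.norm_ofNat]
    linarith
  have hmaps : Set.MapsTo K (Metric.closedBall 0 0.45) (Metric.closedBall 0 0.45) := by
    intro s hs
    rw [mem_closedBall_zero_iff] at hs ⊢
    have h1 := hKlip s 0 hs (by norm_num)
    rw [sub_zero] at h1
    have h2 := norm_sub_norm_le (K s) (K 0)
    linarith
  have hcontr : ContractingWith 0.276 (hmaps.restrict K _ _) := by
    refine ⟨by rw [← NNReal.coe_lt_coe]; norm_num, LipschitzWith.of_dist_le_mul fun x y => ?_⟩
    have := hKlip x y (mem_closedBall_zero_iff.1 x.2) (mem_closedBall_zero_iff.1 y.2)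
    rw [Subtype.dist_eq, Subtype.dist_eq, dist_eq_norm, dist_eq_norm]
    simpa using this
  obtain ⟨s, hs, hfix, -⟩ := hcontr.exists_fixedPoint' Metric.isClosed_closedBall.isComplete hmaps
    (Metric.mem_closedBall_self (by norm_num)) (edist_ne_top _ _)
  rw [mem_closedBall_zero_iff] at hs
  refine ⟨a + s, hmem s hs, ?_, ?_⟩
  · intro h0
    have h1 : ‖a‖ = ‖s‖ := by rw [eq_neg_of_add_eq_zero_left h0, norm_neg]
    have := Real.pi_gt_three
    linarith
  · have hfix' : K s = s := hfix
    have h1 : q (a + s) - q (-(a + s)) = 2 * Complex.sinh s := by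
      have : (q (a + s) - q (-(a + s))) / 2 = Complex.sinh s := by
        simp only [hK] at hfix'
        linear_combination hfix'
      linear_combination 2 * this
    have e1 : Complex.exp (a + s) = -Complex.exp s := by
      rw [Complex.exp_add, ha, Complex.exp_pi_mul_I]; ring
    have e2 : Complex.exp (-(a + s)) = -Complex.exp (-s) := by
      rw [neg_add, Complex.exp_add, Complex.exp_neg a, ha, Complex.exp_pi_mul_I]
      norm_num
    have e3 : 2 * Complex.sinh s = Complex.exp s - Complex.exp (-s) := by
      rw [Complex.sinh]; ring
    simp only [hq] at h1
    rw [e1, e2, e3] at h1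
    linear_combination h1

/-! ### The unit disk and its automorphisms. -/

lemma isOpen_disk : IsOpen disk := Metric.isOpen_ball

lemma mem_disk {z : ℂ} : z ∈ disk ↔ ‖z‖ < 1 := mem_ball_zero_iff

lemma zero_mem_disk : (0 : ℂ) ∈ disk := by simp [mem_disk]

lemma one_sub_norm_sq_pos {z : ℂ} (hz : z ∈ disk) : 0 < 1 - ‖z‖ ^ 2 := by
  have := mem_disk.1 hz
  nlinarith [norm_nonneg z]

lemma norm_conj_mul_lt_one {α z : ℂ} (hα : α ∈ disk) (hz : z ∈ disk) : ‖conj α * z‖ < 1 := by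
  rw [norm_mul, RCLike.norm_conj]
  exact mul_lt_one_of_nonneg_of_lt_one_left (norm_nonneg _) (mem_disk.1 hα) (mem_disk.1 hz).le

lemma one_add_mem_slitPlane {w : ℂ} (hw : ‖w‖ < 1) : 1 + w ∈ Complex.slitPlane := by
  left
  have := (abs_lt.1 ((Complex.abs_re_le_norm w).trans_lt hw)).1
  simp only [Complex.add_re, Complex.one_re]
  linarith

lemma one_add_conj_mul_mem_slitPlane {α z : ℂ} (hα : α ∈ disk) (hz : z ∈ disk) :
    1 + conj α * z ∈ Complex.slitPlane :=
  one_add_mem_slitPlane (norm_conj_mul_lt_one hα hz)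

lemma one_add_conj_mul_ne_zero {α z : ℂ} (hα : α ∈ disk) (hz : z ∈ disk) :
    1 + conj α * z ≠ 0 :=
  Complex.slitPlane_ne_zero (one_add_conj_mul_mem_slitPlane hα hz)

lemma norm_one_add_conj_mul_sq (α z : ℂ) :
    ‖1 + conj α * z‖ ^ 2 = ‖α + z‖ ^ 2 + (1 - ‖α‖ ^ 2) * (1 - ‖z‖ ^ 2) := by
  simp only [Complex.sq_norm, Complex.normSq_apply, Complex.add_re, Complex.add_im,
    Complex.mul_re, Complex.mul_im, Complex.conj_re, Complex.conj_im, Complex.one_re,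
    Complex.one_im]
  ring

lemma one_sub_norm_diskAut_sq {α z : ℂ} (hα : α ∈ disk) (hz : z ∈ disk) :
    1 - ‖diskAut α z‖ ^ 2 = (1 - ‖α‖ ^ 2) * (1 - ‖z‖ ^ 2) / ‖1 + conj α * z‖ ^ 2 := by
  have h0 : ‖1 + conj α * z‖ ^ 2 ≠ 0 := by simpa using one_add_conj_mul_ne_zero hα hz
  rw [diskAut, norm_div, div_pow, eq_div_iff h0, sub_mul, div_mul_cancel₀ _ h0,
    norm_one_add_conj_mul_sq]
  ring

lemma diskAut_mem_disk {α z : ℂ} (hα : α ∈ disk) (hz : z ∈ disk) : diskAut α z ∈ disk := by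
  have h : 0 < 1 - ‖diskAut α z‖ ^ 2 := by
    rw [one_sub_norm_diskAut_sq hα hz]
    have := one_sub_norm_sq_pos hα
    have := one_sub_norm_sq_pos hz
    have := norm_pos_iff.2 (one_add_conj_mul_ne_zero hα hz)
    positivity
  rw [mem_disk]
  nlinarith [norm_nonneg (diskAut α z)]

lemma hasDerivAt_diskAut {α z : ℂ} (hα : α ∈ disk) (hz : z ∈ disk) :
    HasDerivAt (diskAut α) ((1 - (‖α‖ : ℂ) ^ 2) / (1 + conj α * z) ^ 2) z := by
  have h0 := one_add_conj_mul_ne_zero hα hz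
  have h1 : HasDerivAt (fun z => α + z) 1 z := (hasDerivAt_id z).const_add α
  have h2 : HasDerivAt (fun z => 1 + conj α * z) (conj α) z := by
    simpa using ((hasDerivAt_id z).const_mul (conj α)).const_add 1
  refine (h1.div h2 h0).congr_deriv ?_
  have : conj α * α = (‖α‖ : ℂ) ^ 2 := Complex.conj_mul' α
  rw [← this]
  ring

lemma diskAut_injOn {α : ℂ} (hα : α ∈ disk) : Set.InjOn (diskAut α) disk := by
  intro z hz w hw h
  rw [diskAut, diskAut, div_eq_div_iff (one_add_conj_mul_ne_zero hα hz)
    (one_add_conj_mul_ne_zero hα hw)] at h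
  have h1 : (1 - (‖α‖ : ℂ) ^ 2) * (z - w) = 0 := by
    have : conj α * α = (‖α‖ : ℂ) ^ 2 := Complex.conj_mul' α
    rw [← this]
    linear_combination h
  have h2 : (1 - (‖α‖ : ℂ) ^ 2) ≠ 0 := by
    exact_mod_cast (one_sub_norm_sq_pos hα).ne'
  exact sub_eq_zero.1 ((mul_eq_zero.1 h1).resolve_left h2)

lemma diskAut_zero (α : ℂ) : diskAut α 0 = α := by simp [diskAut]

/-! ### Schwarz–Pick and near-constancy at an extremal point. -/

/-- A consequence of the Schwarz–Pick lemma. -/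
lemma IsAnalyticSelfMap.norm_sub_apply_zero_le {ω : ℂ → ℂ} (hω : IsAnalyticSelfMap ω) {z : ℂ}
    (hz : z ∈ disk) : ‖ω z - ω 0‖ ≤ (1 - ‖ω 0‖ ^ 2) * (‖z‖ / (1 - ‖z‖)) := by
  set b := ω 0
  have hb : b ∈ disk := hω.2 zero_mem_disk
  have hnb : -b ∈ disk := by rwa [mem_disk, norm_neg, ← mem_disk]
  have hd : DifferentiableOn ℂ (fun z => diskAut (-b) (ω z)) disk := fun x hx =>
    (hasDerivAt_diskAut hnb (hω.2 hx)).differentiableAt.comp_differentiableWithinAt x (hω.1 x hx)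
  have h := Complex.norm_le_norm_of_mapsTo_ball hd
    (fun x hx => Metric.ball_subset_closedBall (diskAut_mem_disk hnb (hω.2 hx)))
    (by simp [diskAut, b]) (mem_disk.1 hz)
  have h0 := norm_pos_iff.2 (one_add_conj_mul_ne_zero hnb (hω.2 hz))
  rw [diskAut, norm_div, div_le_iff₀ h0] at h
  have e1 : -b + ω z = ω z - b := by ring
  -- In this form the Schwarz bound becomes a linear inequality in `|ω z - b|`, which can be solved.
  have e2 : 1 + conj (-b) * ω z = (1 - (‖b‖ : ℂ) ^ 2) - conj b * (ω z - b) := by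
    rw [← Complex.conj_mul', map_neg]; ring
  have h1 : ‖1 + conj (-b) * ω z‖ ≤ (1 - ‖b‖ ^ 2) + ‖ω z - b‖ := by
    rw [e2]
    refine (_root_.norm_sub_le _ _).trans (add_le_add ?_ ?_)
    · have : (1 - (‖b‖ : ℂ) ^ 2) = ((1 - ‖b‖ ^ 2 : ℝ) : ℂ) := by push_cast; ring
      rw [this, Complex.norm_real, Real.norm_of_nonneg (one_sub_norm_sq_pos hb).le]
    · rw [norm_mul, RCLike.norm_conj]
      exact mul_le_of_le_one_left (norm_nonneg _) (mem_disk.1 hb).le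
  rw [e1] at h
  have h2 := h.trans (mul_le_mul_of_nonneg_left h1 (norm_nonneg z))
  have h3 : 0 < 1 - ‖z‖ := by have := mem_disk.1 hz; linarith
  rw [← mul_div_assoc, le_div_iff₀ h3]
  linarith

/-- If the derivative of `f` at `z` is at most `k |z|`, then `f` deviates from `f 0` by at most
`k |z|² / 2`. -/
lemma norm_sub_le_of_norm_deriv_le_mul {f f' : ℂ → ℂ} {z : ℂ} {k : ℝ}
    (hf : ∀ w, ‖w‖ ≤ ‖z‖ → HasDerivAt f (f' w) w) (hf' : ∀ w, ‖w‖ ≤ ‖z‖ → ‖f' w‖ ≤ k * ‖w‖) :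
    ‖f z - f 0‖ ≤ k / 2 * ‖z‖ ^ 2 := by
  have hle : ∀ t ∈ Set.Icc (0 : ℝ) 1, ‖(t : ℂ) * z‖ ≤ ‖z‖ := fun t ht => by
    rw [norm_mul, Complex.norm_real, Real.norm_of_nonneg ht.1]
    exact mul_le_of_le_one_left (norm_nonneg _) ht.2
  have hd : ∀ t ∈ Set.Icc (0 : ℝ) 1,
      HasDerivAt (fun t : ℝ => f (t * z) - f 0) (f' (t * z) * z) t := fun t ht => by
    have h1 : HasDerivAt (fun s : ℂ => s * z) z (t : ℂ) := by
      simpa using (hasDerivAt_id (t : ℂ)).mul_const z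
    exact (((hf _ (hle t ht)).comp (t : ℂ) h1).comp_ofReal).sub_const (f 0)
  have hB : ∀ t : ℝ, HasDerivAt (fun t : ℝ => k / 2 * ‖z‖ ^ 2 * t ^ 2) (k * ‖z‖ ^ 2 * t) t :=
    fun t => ((hasDerivAt_pow 2 t).const_mul _).congr_deriv (by norm_num; ring)
  have := image_norm_le_of_norm_deriv_right_le_deriv_boundary (a := 0) (b := 1)
    (fun t ht => (hd t ht).continuousAt.continuousWithinAt)
    (fun t ht => (hd t (Set.Ico_subset_Icc_self ht)).hasDerivWithinAt) (by simp) hB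
    (fun t ht => by
      have h1 := hf' _ (hle t (Set.Ico_subset_Icc_self ht))
      rw [norm_mul (t : ℂ), Complex.norm_real, Real.norm_of_nonneg ht.1] at h1
      rw [norm_mul]
      nlinarith [norm_nonneg z, mul_le_mul_of_nonneg_right h1 (norm_nonneg z)])
    (Set.right_mem_Icc.2 zero_le_one)
  simpa using this

/-- A function with growth `M / (1 - |z|²)` that has its largest possible modulus at the
origin is nearly constant at distance of order `1 / M` from the origin. -/
lemma norm_sub_zero_le_of_growth {u : ℂ → ℂ} {M : ℝ} (hM : 100.9 ≤ M)
    (hu : DifferentiableOn ℂ u disk) (hle : ∀ z ∈ disk, ‖u z‖ ≤ M / (1 - ‖z‖ ^ 2))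
    (h0 : ‖u 0‖ = M) {z : ℂ} (hz : M * ‖z‖ ≤ 3.673) : ‖u z - u 0‖ ≤ 29.6 * ‖z‖ := by
  have hM0 : 0 < M := by linarith
  -- The bound `2D|z|/(R - |z|)` with `D ≈ MR²` is best near `R = 2|z|`, and `7.3` is close to `2 ·
  -- 3.673`.
  set R := 7.3 / M with hR
  have hR0 : 0 < R := by positivity
  have hR1 : R ≤ 0.07235 := by rw [hR, div_le_iff₀ hM0]; linarith
  have hR2 : R ^ 2 ≤ 0.00524 := by nlinarith
  have hMR : M * R = 7.3 := by rw [hR]; field_simp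
  have hu0 : u 0 ≠ 0 := by rw [← norm_pos_iff, h0]; exact hM0
  set D := M * R ^ 2 / (1 - R ^ 2) with hD
  have hD0 : 0 < D := div_pos (by positivity) (by linarith)
  have hsub : Metric.ball (0 : ℂ) R ⊆ disk := Metric.ball_subset_ball (by linarith)
  have hzR : ‖z‖ < R := by
    rw [hR, lt_div_iff₀ hM0]; linarith
  -- The unimodular factor `M / u 0` rotates `u 0` to `M`. Extremality at `0` then bounds the real
  -- part of the difference by `M/(1 - R²) - M = D`, of order only `1/M`.
  have key := Complex.borelCaratheodory_zero (f := fun z => (u z - u 0) * (M / u 0)) hD0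
    (((hu.mono hsub).sub_const _).mul_const _) (fun w hw => by
      have hwR := mem_ball_zero_iff.1 hw
      have h1 := hle w (hsub hw)
      have h2 : M / (1 - ‖w‖ ^ 2) ≤ M / (1 - R ^ 2) := by
        have h3 : ‖w‖ ^ 2 ≤ R ^ 2 := by gcongr
        have h4 : 0 < 1 - R ^ 2 := by linarith
        gcongr
      have h3 : ‖u w * (M / u 0)‖ ≤ M / (1 - R ^ 2) := by
        rw [norm_mul, norm_div, h0, Complex.norm_real, Real.norm_of_nonneg hM0.le,
          div_self hM0.ne', mul_one]
        exact h1.trans h2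
      have h4 : (u w - u 0) * (M / u 0) = u w * (M / u 0) - M := by field_simp
      have h5 := (Complex.re_le_norm _).trans h3
      change ((u w - u 0) * (M / u 0)).re ≤ D
      rw [h4, Complex.sub_re, Complex.ofReal_re]
      have h6 : M / (1 - R ^ 2) - M = D := by
        rw [hD]; field_simp [show 1 - R ^ 2 ≠ 0 by linarith]; ring
      linarith) hR0 (mem_ball_zero_iff.2 hzR) (by simp)
  rw [norm_mul, norm_div, h0, Complex.norm_real, Real.norm_of_nonneg hM0.le,
          div_self hM0.ne', mul_one] at key
  refine key.trans ?_
  rw [div_le_iff₀ (by linarith), hD]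
  have hne : 0 < 1 - R ^ 2 := by linarith
  rw [mul_div_assoc', div_mul_eq_mul_div, div_le_iff₀ hne]
  have h7 : 3.627 ≤ M * (R - ‖z‖) := by rw [mul_sub, hMR]; linarith
  have h8 : 2 * (M * R ^ 2) ≤ 29.6 * (R - ‖z‖) * (1 - R ^ 2) := by
    have h9 : M * (2 * (M * R ^ 2)) = 2 * 7.3 ^ 2 := by rw [← hMR]; ring
    have h10 : M * (29.6 * (R - ‖z‖) * (1 - R ^ 2))
        = 29.6 * (M * (R - ‖z‖)) * (1 - R ^ 2) := by ring
    refine le_of_mul_le_mul_left ?_ hM0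
    rw [h9, h10]
    nlinarith
  nlinarith [mul_le_mul_of_nonneg_right h8 (norm_nonneg z)]

lemma norm_exp_sub_one_le_exp_sub_one (x : ℂ) : ‖Complex.exp x - 1‖ ≤ Real.exp ‖x‖ - 1 := by
  simpa using Complex.norm_exp_sub_sum_le_exp_norm_sub_sum x 1

lemma exp_small_sub_one_le : Real.exp 0.0211 - 1 ≤ 0.0215 := by
  have := Real.exp_bound' (x := 0.0211) (by norm_num) (by norm_num) (n := 3) (by norm_num)
  norm_num [Finset.sum_range_succ, Nat.factorial] at this ⊢
  linarith

/-- Near the origin, a function whose derivative `u - 2 conj α / (1 + conj α z)` has `u` of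
extremal growth is nearly affine. -/
lemma norm_sub_linear_le {χ u : ℂ → ℂ} {α : ℂ} {M : ℝ} (hM : 100.9 ≤ M) (hα : α ∈ disk)
    (hχ : ∀ z ∈ disk, HasDerivAt χ (u z - 2 * conj α / (1 + conj α * z)) z)
    (hu : DifferentiableOn ℂ u disk) (hle : ∀ z ∈ disk, ‖u z‖ ≤ M / (1 - ‖z‖ ^ 2))
    (h0 : ‖u 0‖ = M) {z : ℂ} (hz : M * ‖z‖ ≤ 3.673) :
    ‖χ z - χ 0 - (u 0 - 2 * conj α) * z‖ ≤ 0.0211 := by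
  have hsmall : ∀ w : ℂ, ‖w‖ ≤ ‖z‖ → ‖w‖ ≤ 0.03641 ∧ M * ‖w‖ ≤ 3.673 := fun w hw => by
    have h1 : M * ‖w‖ ≤ 3.673 := (mul_le_mul_of_nonneg_left hw (by linarith)).trans hz
    exact ⟨by nlinarith [norm_nonneg w], h1⟩
  have hdisk : ∀ w : ℂ, ‖w‖ ≤ ‖z‖ → w ∈ disk := fun w hw =>
    mem_disk.2 (by linarith [(hsmall w hw).1])
  have hα1 := mem_disk.1 hα
  -- Here `31.7 = 29.6 + 2.1`: the variation of `u` plus that of the automorphism term, where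
  -- `2/0.963 < 2.1`.
  have key := norm_sub_le_of_norm_deriv_le_mul (z := z) (k := 31.7)
    (f := fun w => χ w - (u 0 - 2 * conj α) * w)
    (f' := fun w => u w - 2 * conj α / (1 + conj α * w) - (u 0 - 2 * conj α))
    (fun w hw => (hχ w (hdisk w hw)).sub
      (by simpa using (hasDerivAt_id w).const_mul (u 0 - 2 * conj α)))
    (fun w hw => by
      have hwd := hdisk w hw
      obtain ⟨h1, h2⟩ := hsmall w hw
      have h3 := norm_sub_zero_le_of_growth hM hu hle h0 h2
      have hne := one_add_conj_mul_ne_zero hα hwd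
      have e : u w - 2 * conj α / (1 + conj α * w) - (u 0 - 2 * conj α)
          = (u w - u 0) + 2 * conj α * (conj α * w) / (1 + conj α * w) := by
        field_simp; ring
      rw [e]
      refine (norm_add_le _ _).trans ?_
      have h4 : ‖conj α * w‖ ≤ ‖w‖ := by
        rw [norm_mul, RCLike.norm_conj]
        exact mul_le_of_le_one_left (norm_nonneg _) hα1.le
      have h5 : 0.963 ≤ ‖1 + conj α * w‖ := by
        have := norm_sub_le_norm_add 1 (conj α * w)
        rw [norm_one] at this
        linarith
      have h6 : ‖2 * conj α * (conj α * w) / (1 + conj α * w)‖ ≤ 2.1 * ‖w‖ := by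
        rw [norm_div, norm_mul, norm_mul, RCLike.norm_ofNat, RCLike.norm_conj,
          div_le_iff₀ (by linarith)]
        have h7 : 2 * ‖α‖ * ‖conj α * w‖ ≤ 2 * 1 * ‖w‖ := by gcongr
        nlinarith [norm_nonneg w]
      linarith)
  obtain ⟨h1, -⟩ := hsmall z le_rfl
  have e : χ z - χ 0 - (u 0 - 2 * conj α) * z
      = (χ z - (u 0 - 2 * conj α) * z) - (χ 0 - (u 0 - 2 * conj α) * 0) := by ring
  rw [e]
  refine key.trans ?_
  nlinarith [norm_nonneg z]

/-! ### Extremal growth contradicts univalence. -/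

/-- Affine maps `w ↦ w - conj b * conj w` with `|b| < 1` are injective. -/
lemma eq_of_sub_conj_mul_conj_eq {b x y : ℂ} (hb : ‖b‖ < 1)
    (h : x - conj b * conj x = y - conj b * conj y) : x = y := by
  have h1 : x - y = conj b * conj (x - y) := by rw [map_sub]; linear_combination h
  have h2 : ‖x - y‖ = ‖b‖ * ‖x - y‖ := by
    conv_lhs => rw [h1]
    rw [norm_mul, RCLike.norm_conj, RCLike.norm_conj]
  have h3 : ‖x - y‖ = 0 := by nlinarith [norm_nonneg (x - y)]
  exact sub_eq_zero.1 (norm_eq_zero.1 h3)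

/-- A harmonic function whose analytic part has a pre-Schwarzian derivative of large extremal
growth at the origin is not univalent: it is close to an affine image of an exponential. -/
lemma not_injOn_of_extremal {H G ω χ u : ℂ → ℂ} {α C : ℂ} {M : ℝ} (hM : 100.9 ≤ M)
    (hα : α ∈ disk) (hC : C ≠ 0) (hω : IsAnalyticSelfMap ω)
    (hH : ∀ z ∈ disk, HasDerivAt H (C * Complex.exp (χ z)) z)
    (hG : ∀ z ∈ disk, HasDerivAt G (ω z * (C * Complex.exp (χ z))) z)
    (hχ : ∀ z ∈ disk, HasDerivAt χ (u z - 2 * conj α / (1 + conj α * z)) z)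
    (hu : DifferentiableOn ℂ u disk) (hle : ∀ z ∈ disk, ‖u z‖ ≤ M / (1 - ‖z‖ ^ 2))
    (h0 : ‖u 0‖ = M) : ¬ Set.InjOn (fun z => H z + conj (G z)) disk := by
  intro hinj
  set N := u 0 - 2 * conj α with hN
  have hα1 := mem_disk.1 hα
  have hNM : M - 2 ≤ ‖N‖ := by
    have h1 := norm_sub_norm_le (u 0) (2 * conj α)
    rw [norm_mul, RCLike.norm_ofNat, RCLike.norm_conj, h0] at h1
    linarith
  have hN0 : 0 < ‖N‖ := by linarith
  have hNne : N ≠ 0 := norm_pos_iff.1 hN0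
  -- As `|N| ≥ M - 2`, the worst case is `3.6 · 100.9/98.9 < 3.673`.
  have hscale : ∀ w ∈ Metric.ball (0 : ℂ) 3.6, M * ‖w / N‖ ≤ 3.673 := fun w hw => by
    rw [mem_ball_zero_iff] at hw
    rw [norm_div, mul_div_assoc', div_le_iff₀ hN0]
    nlinarith
  have hsmall : ∀ w ∈ Metric.ball (0 : ℂ) 3.6, ‖w / N‖ ≤ 0.03641 := fun w hw => by
    nlinarith [hscale w hw, norm_nonneg (w / N)]
  have hdisk : ∀ w ∈ Metric.ball (0 : ℂ) 3.6, w / N ∈ disk := fun w hw =>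
    mem_disk.2 (by linarith [hsmall w hw])
  set b := ω 0
  have hbd : b ∈ disk := hω.2 zero_mem_disk
  have hb := mem_disk.1 hbd
  have hbsq := one_sub_norm_sq_pos hbd
  have hbC : (1 - (‖b‖ : ℂ) ^ 2) ≠ 0 := by exact_mod_cast hbsq.ne'
  have hbb : conj b * b = (‖b‖ : ℂ) ^ 2 := Complex.conj_mul' b
  -- This makes the derivative of `κ H(w/N)` equal to `1` at `w = 0`.
  set κ : ℂ := N / (C * Complex.exp (χ 0)) with hκ
  have hκ0 : κ ≠ 0 := div_ne_zero hNne (mul_ne_zero hC (Complex.exp_ne_zero _))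
  -- The derivative of `V` carries the factor `(ω - b)/(1 - |b|²)`, which Schwarz–Pick bounds
  -- uniformly in `b`, even as `|b| → 1`.
  set V : ℂ → ℂ := fun z => (G z - b * H z) / (1 - (‖b‖ : ℂ) ^ 2) with hV
  have hscaled : ∀ (f : ℂ → ℂ) (f' : ℂ → ℂ), (∀ z ∈ disk, HasDerivAt f (f' z) z) →
      ∀ w ∈ Metric.ball (0 : ℂ) 3.6,
        HasDerivAt (fun w => κ * f (w / N)) (κ / N * f' (w / N)) w := fun f f' hf w hw => by
    have h1 : HasDerivAt (fun w => w / N) (1 / N) w := (hasDerivAt_id w).div_const N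
    exact (((hf _ (hdisk w hw)).comp w h1).const_mul κ).congr_deriv (by ring)
  have hVd : ∀ z ∈ disk, HasDerivAt V
      ((ω z - b) / (1 - (‖b‖ : ℂ) ^ 2) * (C * Complex.exp (χ z))) z := fun z hz =>
    (((hG z hz).sub ((hH z hz).const_mul b)).div_const _).congr_deriv (by ring)
  have hexp : ∀ w ∈ Metric.ball (0 : ℂ) 3.6,
      ‖κ / N * (C * Complex.exp (χ (w / N))) - Complex.exp w‖ ≤ 0.0215 * ‖Complex.exp w‖ := by
    intro w hw
    have h1 := norm_sub_linear_le hM hα hχ hu hle h0 (hscale w hw)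
    rw [← hN, mul_div_cancel₀ _ hNne] at h1
    have e : κ / N * (C * Complex.exp (χ (w / N)))
        = Complex.exp w * Complex.exp (χ (w / N) - χ 0 - w) := by
      rw [← Complex.exp_add, show w + (χ (w / N) - χ 0 - w) = χ (w / N) - χ 0 by ring,
        Complex.exp_sub, hκ]
      field_simp
    have e2 : ∀ x : ℂ, Complex.exp w * x - Complex.exp w = (x - 1) * Complex.exp w := by
      intro x; ring
    rw [e, e2, norm_mul]
    refine mul_le_mul_of_nonneg_right ?_ (norm_nonneg _)
    refine (norm_exp_sub_one_le_exp_sub_one _).trans (le_trans ?_ exp_small_sub_one_le)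
    have := Real.exp_le_exp.2 h1
    linarith
  have hW' : ∀ w ∈ Metric.ball (0 : ℂ) 3.6,
      ‖κ / N * ((ω (w / N) - b) / (1 - (‖b‖ : ℂ) ^ 2) * (C * Complex.exp (χ (w / N))))‖
        ≤ 0.0387 * ‖Complex.exp w‖ := by
    intro w hw
    have h1 : ‖κ / N * (C * Complex.exp (χ (w / N)))‖ ≤ 1.0215 * ‖Complex.exp w‖ := by
      have := norm_le_norm_sub_add (κ / N * (C * Complex.exp (χ (w / N)))) (Complex.exp w)
      linarith [hexp w hw]
    have h2 : ‖(ω (w / N) - b) / (1 - (‖b‖ : ℂ) ^ 2)‖ ≤ 0.0378 := by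
      have e : (1 - (‖b‖ : ℂ) ^ 2) = ((1 - ‖b‖ ^ 2 : ℝ) : ℂ) := by push_cast; ring
      rw [norm_div, e, Complex.norm_real, Real.norm_of_nonneg hbsq.le, div_le_iff₀ hbsq, mul_comm]
      refine (hω.norm_sub_apply_zero_le (hdisk w hw)).trans
        (mul_le_mul_of_nonneg_left ?_ hbsq.le)
      have := hsmall w hw
      rw [div_le_iff₀ (by linarith)]
      linarith
    have e : κ / N * ((ω (w / N) - b) / (1 - (‖b‖ : ℂ) ^ 2) * (C * Complex.exp (χ (w / N))))
        = (ω (w / N) - b) / (1 - (‖b‖ : ℂ) ^ 2) * (κ / N * (C * Complex.exp (χ (w / N)))) := by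
      ring
    rw [e, norm_mul]
    refine (mul_le_mul h2 h1 (norm_nonneg _) (by norm_num)).trans ?_
    nlinarith [norm_nonneg (Complex.exp w)]
  have hc : ‖κ / conj κ‖ ≤ 1 := by
    rw [norm_div, RCLike.norm_conj, div_self (norm_ne_zero_iff.2 hκ0)]
  -- The total perturbation is `0.0215 + 2 · 0.0387 = 0.0989 ≤ 0.1`. The choice `c = κ / conj κ`
  -- turns `conj (κ V)` into `κ conj V`, so that `κ` factors out.
  obtain ⟨w, hw, hw0, heq⟩ := exists_ne_zero_eq_neg hb.le hc (l₁ := 0.0215) (l₂ := 0.0387)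
    (by norm_num) (by norm_num) (by norm_num) (hscaled H _ hH) (hscaled V _ hVd) hexp hW'
  have hcκ : conj κ ≠ 0 := (map_ne_zero _).2 hκ0
  have haff : ∀ z : ℂ, κ * H z - conj b * (κ * V z) + κ / conj κ * conj (κ * V z)
      = κ / (1 - (‖b‖ : ℂ) ^ 2) * ((H z + conj (G z)) - conj b * conj (H z + conj (G z))) := by
    intro z
    have hbar : conj (1 - (‖b‖ : ℂ) ^ 2) = 1 - (‖b‖ : ℂ) ^ 2 := by simp
    have hd : (1 - (‖b‖ : ℂ) ^ 2) = 1 - conj b * b := by rw [hbb]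
    simp only [hV, map_mul, map_div₀, hbar]
    simp only [map_sub, map_add, map_mul, Complex.conj_conj]
    clear_value V
    generalize (1 - (‖b‖ : ℂ) ^ 2) = d at hd hbC ⊢
    field_simp
    rw [hd]
    ring
  simp only [haff] at heq
  have h1 := eq_of_sub_conj_mul_conj_eq hb (mul_left_cancel₀ (div_ne_zero hκ0 hbC) heq)
  have hw' : -w ∈ Metric.ball (0 : ℂ) 3.6 := by
    rw [mem_ball_zero_iff] at hw ⊢; rwa [norm_neg]
  have h2 := hinj (hdisk w hw) (hdisk (-w) hw') h1
  have h3 : w = -w := by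
    have := congrArg (· * N) h2
    simpa [div_mul_cancel₀ _ hNne] using this
  exact hw0 (self_eq_neg.1 h3)

/-! ### Jacobians of harmonic functions and branches of `log H'`. -/

lemma hasDerivAt_of_differentiableOn_disk {f : ℂ → ℂ} (hf : DifferentiableOn ℂ f disk) {z : ℂ}
    (hz : z ∈ disk) : HasDerivAt f (deriv f z) z :=
  (hf.differentiableAt (isOpen_disk.mem_nhds hz)).hasDerivAt

lemma det_smul_add_conj_smul (a b : ℂ) :
    (a • (1 : ℂ →L[ℝ] ℂ) + (Complex.conjCLE : ℂ →L[ℝ] ℂ).comp (b • (1 : ℂ →L[ℝ] ℂ))).det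
      = ‖a‖ ^ 2 - ‖b‖ ^ 2 := by
  rw [ContinuousLinearMap.det, ← LinearMap.det_toMatrix Complex.basisOneI, Matrix.det_fin_two]
  simp [LinearMap.toMatrix_apply, Complex.sq_norm, Complex.normSq_apply]
  ring

lemma IsCanonicalDecomposition.jacobian_eq {f h g : ℂ → ℂ} (hf : IsCanonicalDecomposition f h g)
    {z : ℂ} (hz : z ∈ disk) : jacobian f z = ‖deriv h z‖ ^ 2 - ‖deriv g z‖ ^ 2 := by
  have h1 := (hasDerivAt_of_differentiableOn_disk hf.analytic_left hz).complexToReal_fderiv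
  have h2 := (hasDerivAt_of_differentiableOn_disk hf.analytic_right hz).complexToReal_fderiv
  have h3 := h1.add ((Complex.conjCLE : ℂ →L[ℝ] ℂ).hasFDerivAt.comp z h2)
  have heq : f =ᶠ[nhds z] (h + (Complex.conjCLE : ℂ →L[ℝ] ℂ) ∘ g) := by
    filter_upwards [isOpen_disk.mem_nhds hz] with w hw
    simpa using hf.eqOn w hw
  rw [jacobian, heq.fderiv_eq, h3.fderiv, det_smul_add_conj_smul]

lemma IsCanonicalDecomposition.harmonicOnNhd {f h g : ℂ → ℂ}
    (hf : IsCanonicalDecomposition f h g) : InnerProductSpace.HarmonicOnNhd f disk := by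
  intro z hz
  have h1 := (hf.analytic_left.analyticAt (isOpen_disk.mem_nhds hz)).harmonicAt
  have h2 := (hf.analytic_right.analyticAt (isOpen_disk.mem_nhds hz)).harmonicAt_conj
  refine (InnerProductSpace.harmonicAt_congr_nhds ?_).2 (h1.add h2)
  filter_upwards [isOpen_disk.mem_nhds hz] with w hw
  simpa using hf.eqOn w hw

lemma IsCanonicalDecomposition.norm_deriv_lt {f h g : ℂ → ℂ} (hf : IsCanonicalDecomposition f h g)
    (hs : SensePreserving f) {z : ℂ} (hz : z ∈ disk) : ‖deriv g z‖ < ‖deriv h z‖ := by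
  have h1 := hs z hz
  rw [hf.jacobian_eq hz] at h1
  exact lt_of_pow_lt_pow_left₀ 2 (norm_nonneg _) (by linarith)

lemma exists_isLogOfDeriv {H : ℂ → ℂ} (hH : DifferentiableOn ℂ H disk)
    (hne : ∀ z ∈ disk, deriv H z ≠ 0) : ∃ h : ℂ → ℂ, IsLogOfDeriv h H := by
  have hH' : DifferentiableOn ℂ (deriv H) disk := hH.deriv isOpen_disk
  have hH'' : DifferentiableOn ℂ (deriv (deriv H)) disk := hH'.deriv isOpen_disk
  obtain ⟨h, h0, hd⟩ := ((hH''.div hH' hne).isExactOn_ball).with_val_at 0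
    (Complex.log (deriv H 0))
  refine ⟨h, fun z hz => (hd z hz).differentiableAt.differentiableWithinAt, fun z hz => ?_⟩
  -- With `h` a primitive of `H''/H'`, the quotient `H'/exp h` is constant; the value of `h` at `0`
  -- makes it `1`.
  have hder : ∀ w ∈ disk, HasDerivAt (fun w => Complex.exp (-h w) * deriv H w) 0 w := fun w hw =>
    ((hd w hw).neg.cexp.mul (hasDerivAt_of_differentiableOn_disk hH' hw)).congr_deriv (by
      have := hne w hw
      simp only [Pi.div_apply]
      field_simp
      ring)
  have hconst := (convex_ball (0 : ℂ) 1).is_const_of_fderivWithin_eq_zero (𝕜 := ℂ)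
    (fun w hw => (hder w hw).differentiableAt.differentiableWithinAt)
    (fun w hw => by
      rw [fderivWithin_of_isOpen Metric.isOpen_ball hw]
      ext
      simp [(hder w hw).deriv]) hz zero_mem_disk
  simp only [h0, Complex.exp_neg, Complex.exp_log (hne 0 zero_mem_disk)] at hconst
  rw [inv_mul_cancel₀ (hne 0 zero_mem_disk), inv_mul_eq_one₀ (Complex.exp_ne_zero _)] at hconst
  exact hconst

/-! ### The Bloch bound for `log H'`. -/

lemma real_mul_mem_disk {r : ℝ} (hr0 : 0 ≤ r) (hr1 : r < 1) {z : ℂ} (hz : ‖z‖ ≤ 1) :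
    (r : ℂ) * z ∈ disk := by
  rw [mem_disk, norm_mul, Complex.norm_real, Real.norm_of_nonneg hr0]
  nlinarith [norm_nonneg z]

/-- For `r < 1` the weighted quantity is continuous on the closed disk, so a maximum exists. If it
exceeded `100.9`, moving its location to `0` would produce a univalent function excluded by
`not_injOn_of_extremal`. -/
lemma dilated_bound {F H G h : ℂ → ℂ} (hF : IsCanonicalDecomposition F H G)
    (hinj : Univalent F) (hs : SensePreserving F) (hh : IsLogOfDeriv h H) {r : ℝ}
    (hr0 : 0 < r) (hr1 : r < 1) {z : ℂ} (hz : z ∈ disk) :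
    (1 - ‖z‖ ^ 2) * (r * ‖deriv h (r * z)‖) ≤ 100.9 := by
  by_contra! hcon
  have hh' : DifferentiableOn ℂ (deriv h) disk := hh.1.deriv isOpen_disk
  have hcont : ContinuousOn (fun w : ℂ => (1 - ‖w‖ ^ 2) * (r * ‖deriv h (r * w)‖))
      (Metric.closedBall 0 1) := by
    have h1 : ContinuousOn (fun w : ℂ => deriv h (r * w)) (Metric.closedBall 0 1) :=
      hh'.continuousOn.comp (by fun_prop)
        (fun w hw => real_mul_mem_disk hr0.le hr1 (mem_closedBall_zero_iff.1 hw))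
    fun_prop
  obtain ⟨α, hα, hmax⟩ := (isCompact_closedBall (0 : ℂ) 1).exists_isMaxOn
    ⟨0, by simp⟩ hcont
  set M := (1 - ‖α‖ ^ 2) * (r * ‖deriv h (r * α)‖) with hMdef
  have hmax' : ∀ w ∈ disk, (1 - ‖w‖ ^ 2) * (r * ‖deriv h (r * w)‖) ≤ M := fun w hw =>
    hmax (Metric.ball_subset_closedBall hw)
  have hM : 100.9 ≤ M := hcon.le.trans (hmax' z hz)
  have hα1 : α ∈ disk := by
    rw [mem_disk]
    -- On the unit circle the weight `1 - |α|²` vanishes, so the maximum is attained inside.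
    refine lt_of_le_of_ne (mem_closedBall_zero_iff.1 hα) fun h1 => ?_
    rw [hMdef, h1] at hM
    norm_num at hM
  have hαpos := one_sub_norm_sq_pos hα1
  have hαC : (1 - (‖α‖ : ℂ) ^ 2) = ((1 - ‖α‖ ^ 2 : ℝ) : ℂ) := by push_cast; ring
  have hαne : (1 - (‖α‖ : ℂ) ^ 2) ≠ 0 := by rw [hαC]; exact_mod_cast hαpos.ne'
  have hrC : (r : ℂ) ≠ 0 := by exact_mod_cast hr0.ne'
  set Φ : ℂ → ℂ := fun w => r * diskAut α w with hΦ
  have hΦmem : ∀ w ∈ disk, Φ w ∈ disk := fun w hw =>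
    real_mul_mem_disk hr0.le hr1 (mem_disk.1 (diskAut_mem_disk hα1 hw)).le
  set Φ' : ℂ → ℂ := fun w => r * ((1 - (‖α‖ : ℂ) ^ 2) / (1 + conj α * w) ^ 2) with hΦ'
  have hΦd : ∀ w ∈ disk, HasDerivAt Φ (Φ' w) w := fun w hw =>
    (hasDerivAt_diskAut hα1 hw).const_mul _
  have hne : ∀ w ∈ disk, 1 + conj α * w ≠ 0 := fun w hw => one_add_conj_mul_ne_zero hα1 hw
  have hlin : ∀ w, HasDerivAt (fun w => 1 + conj α * w) (conj α) w := fun w => by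
    simpa using ((hasDerivAt_id w).const_mul (conj α)).const_add 1
  have hderivne : ∀ w ∈ disk, deriv H w ≠ 0 := fun w hw => by
    rw [← hh.2 w hw]; exact Complex.exp_ne_zero _
  -- The factor `(1 + conj α w)⁻²` of `Φ'` is absorbed in the exponent as `-2 log(1 + conj α w)`,
  -- the source of the term `2 conj α / (1 + conj α w)`.
  have hexp : ∀ w ∈ disk, (r * (1 - (‖α‖ : ℂ) ^ 2))
      * Complex.exp (h (Φ w) - 2 * Complex.log (1 + conj α * w)) = deriv H (Φ w) * Φ' w := by
    intro w hw
    rw [Complex.exp_sub, hh.2 _ (hΦmem w hw), two_mul, Complex.exp_add,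
      Complex.exp_log (hne w hw), hΦ']
    have := hne w hw
    field_simp
  refine not_injOn_of_extremal (H := H ∘ Φ) (G := G ∘ Φ)
    (ω := fun w => deriv G (Φ w) / deriv H (Φ w))
    (χ := fun w => h (Φ w) - 2 * Complex.log (1 + conj α * w))
    (u := fun w => deriv h (Φ w) * Φ' w) (α := α) (C := r * (1 - (‖α‖ : ℂ) ^ 2)) (M := M)
    hM hα1 (mul_ne_zero hrC hαne) ⟨?_, ?_⟩ ?_ ?_ ?_ ?_ ?_ ?_ ?_
  · intro w hw
    have hG' := (hF.analytic_right.deriv isOpen_disk).differentiableAt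
      (isOpen_disk.mem_nhds (hΦmem w hw))
    have hH' := (hF.analytic_left.deriv isOpen_disk).differentiableAt
      (isOpen_disk.mem_nhds (hΦmem w hw))
    exact ((hG'.comp w (hΦd w hw).differentiableAt).div
      (hH'.comp w (hΦd w hw).differentiableAt) (hderivne _ (hΦmem w hw))).differentiableWithinAt
  · intro w hw
    have h1 := hF.norm_deriv_lt hs (hΦmem w hw)
    rw [mem_disk, norm_div, div_lt_one ((norm_nonneg _).trans_lt h1)]
    exact h1
  · intro w hw
    rw [hexp w hw]
    exact (hasDerivAt_of_differentiableOn_disk hF.analytic_left (hΦmem w hw)).comp w (hΦd w hw)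
  · intro w hw
    rw [hexp w hw, ← mul_assoc, div_mul_cancel₀ _ (hderivne _ (hΦmem w hw))]
    exact (hasDerivAt_of_differentiableOn_disk hF.analytic_right (hΦmem w hw)).comp w (hΦd w hw)
  · intro w hw
    have h1 := (hasDerivAt_of_differentiableOn_disk hh.1 (hΦmem w hw)).comp w (hΦd w hw)
    have h2 := ((hlin w).clog (one_add_conj_mul_mem_slitPlane hα1 hw)).const_mul 2
    exact (h1.sub h2).congr_deriv (by ring)
  · intro w hw
    have h1 := hh'.differentiableAt (isOpen_disk.mem_nhds (hΦmem w hw))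
    have h2 : DifferentiableAt ℂ Φ' w :=
      ((differentiableAt_const _).div ((hlin w).differentiableAt.pow 2)
        (pow_ne_zero 2 (hne w hw))).const_mul _
    exact ((h1.comp w (hΦd w hw).differentiableAt).mul h2).differentiableWithinAt
  · intro w hw
    have h1 := hmax' _ (diskAut_mem_disk hα1 hw)
    have hwpos := one_sub_norm_sq_pos hw
    rw [one_sub_norm_diskAut_sq hα1 hw] at h1
    rw [le_div_iff₀ hwpos, hΦ', hαC]
    simp only [norm_mul, norm_div, norm_pow, Complex.norm_real, Real.norm_of_nonneg hr0.le,
      Real.norm_of_nonneg hαpos.le]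
    refine le_trans (le_of_eq ?_) h1
    simp only [hΦ]
    ring
  · simp only [hΦ, hΦ', diskAut_zero, mul_zero, add_zero, one_pow, div_one]
    rw [hαC, norm_mul, norm_mul, Complex.norm_real, Complex.norm_real,
      Real.norm_of_nonneg hr0.le, Real.norm_of_nonneg hαpos.le, hMdef]
    ring
  · intro w hw v hv hwv
    have hcancel : Φ w = Φ v := by
      refine hinj (hΦmem w hw) (hΦmem v hv) ?_
      rw [hF.eqOn _ (hΦmem w hw), hF.eqOn _ (hΦmem v hv)]
      exact hwv
    exact diskAut_injOn hα1 hw hv (mul_left_cancel₀ hrC hcancel)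

/-- The Bloch seminorm of `log H'` is bounded for univalent sense-preserving harmonic functions
with analytic part `H`. -/
lemma bloch_bound {F H G h : ℂ → ℂ} (hF : IsCanonicalDecomposition F H G)
    (hinj : Univalent F) (hs : SensePreserving F) (hh : IsLogOfDeriv h H) {z : ℂ}
    (hz : z ∈ disk) : (1 - ‖z‖ ^ 2) * ‖deriv h z‖ ≤ 100.9 := by
  have hcont : ContinuousAt (fun r : ℝ => (1 - ‖z‖ ^ 2) * (r * ‖deriv h (r * z)‖)) 1 := by
    have h1 : ContinuousAt (deriv h) (((1 : ℝ) : ℂ) * z) := by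
      rw [Complex.ofReal_one, one_mul]
      exact (hh.1.deriv isOpen_disk).continuousOn.continuousAt (isOpen_disk.mem_nhds hz)
    have h2 : ContinuousAt (fun r : ℝ => deriv h (r * z)) 1 :=
      ContinuousAt.comp (f := fun r : ℝ => (r : ℂ) * z) h1 (by fun_prop)
    fun_prop
  have h1 : Filter.Tendsto (fun r : ℝ => (1 - ‖z‖ ^ 2) * (r * ‖deriv h (r * z)‖))
      (nhdsWithin 1 (Set.Iio 1)) (nhds ((1 - ‖z‖ ^ 2) * ‖deriv h z‖)) := by
    simpa using hcont.tendsto.mono_left nhdsWithin_le_nhds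
  refine le_of_tendsto h1 ?_
  filter_upwards [Ioo_mem_nhdsLT (show (0 : ℝ) < 1 by norm_num)] with r hr
  exact dilated_bound hF hinj hs hh hr.1 hr.2 hz

/-! ### Harmonic functions with prescribed analytic part, and normalized translates. -/

lemma beta_le {f h g ω : ℂ → ℂ} {C : ℝ} (hf : IsCanonicalDecomposition f h g)
    (hω : IsAnalyticSelfMap ω) (hg : HasDilatation h g ω)
    (hC : ∀ z ∈ disk, (1 - ‖z‖ ^ 2) * ‖deriv h z‖ ≤ C) : beta f ≤ ENNReal.ofReal C := by
  refine iSup₂_le fun z hz => ENNReal.ofReal_le_ofReal (le_trans ?_ (hC z hz))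
  refine mul_le_mul_of_nonneg_left (Real.sqrt_le_iff.2 ⟨norm_nonneg _, ?_⟩)
    (one_sub_norm_sq_pos hz).le
  have h1 : ‖deriv g z‖ ≤ ‖deriv h z‖ := by
    rw [hg z hz, norm_mul]
    exact mul_le_of_le_one_left (norm_nonneg _) (mem_disk.1 (hω.2 hz)).le
  have h2 : ‖deriv g z‖ ^ 2 ≤ ‖deriv h z‖ ^ 2 := by gcongr
  rw [hf.jacobian_eq hz, abs_of_nonneg (by linarith)]
  linarith [sq_nonneg ‖deriv g z‖]

lemma exists_coanalytic_part {h ω : ℂ → ℂ} (hh : DifferentiableOn ℂ h disk)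
    (hω : IsAnalyticSelfMap ω) :
    ∃ f g : ℂ → ℂ, IsCanonicalDecomposition f h g ∧ HasDilatation h g ω := by
  obtain ⟨g, hg⟩ := (hω.1.mul (hh.deriv isOpen_disk)).isExactOn_ball
  exact ⟨fun z => h z + conj (g z), g,
    ⟨hh, fun z hz => (hg z hz).differentiableAt.differentiableWithinAt, fun _ _ => rfl⟩,
    fun z hz => (hg z hz).deriv⟩

/-- The normalized translate of a univalent sense-preserving harmonic function is in `S_H`, and its
second analytic coefficient is given by the derivative of `log H'`. -/
lemma exists_memSHWithParts_normalizedTranslate {F H G h : ℂ → ℂ}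
    (hF : IsCanonicalDecomposition F H G) (hinj : Univalent F) (hs : SensePreserving F)
    (hh : IsLogOfDeriv h H) {α : ℂ} (hα : α ∈ disk) :
    ∃ A B : ℂ → ℂ, MemSHWithParts (normalizedTranslate F H α) A B ∧
      (1 - ‖α‖ ^ 2) * ‖deriv h α‖ = 2 * ‖taylorCoeff A 2 + conj α‖ := by
  have hαpos := one_sub_norm_sq_pos hα
  have hαC : (1 - (‖α‖ : ℂ) ^ 2) = ((1 - ‖α‖ ^ 2 : ℝ) : ℂ) := by push_cast; ring
  have hαne : (1 - (‖α‖ : ℂ) ^ 2) ≠ 0 := by rw [hαC]; exact_mod_cast hαpos.ne'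
  have hHne : ∀ w ∈ disk, deriv H w ≠ 0 := fun w hw => by
    rw [← hh.2 w hw]; exact Complex.exp_ne_zero _
  set c : ℂ := (1 - (‖α‖ : ℂ) ^ 2) * deriv H α with hc
  have hc0 : c ≠ 0 := mul_ne_zero hαne (hHne α hα)
  have hmem : ∀ w ∈ disk, diskAut α w ∈ disk := fun w hw => diskAut_mem_disk hα hw
  set φ' : ℂ → ℂ := fun w => (1 - (‖α‖ : ℂ) ^ 2) / (1 + conj α * w) ^ 2 with hφ'
  have hφ'ne : ∀ w ∈ disk, φ' w ≠ 0 := fun w hw =>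
    div_ne_zero hαne (pow_ne_zero 2 (one_add_conj_mul_ne_zero hα hw))
  have hcomp : ∀ (K : ℂ → ℂ) (d : ℂ), DifferentiableOn ℂ K disk → ∀ w ∈ disk,
      HasDerivAt (fun w => (K (diskAut α w) - K α) / d)
        (deriv K (diskAut α w) * φ' w / d) w := fun K d hK w hw =>
    (((hasDerivAt_of_differentiableOn_disk hK (hmem w hw)).comp w
      (hasDerivAt_diskAut hα hw)).sub_const _).div_const d
  set A : ℂ → ℂ := fun w => (H (diskAut α w) - H α) / c with hA
  -- The denominator is `conj c` because the co-analytic part enters conjugated.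
  set B : ℂ → ℂ := fun w => (G (diskAut α w) - G α) / conj c with hB
  have hAd := hcomp H c hF.analytic_left
  have hBd := hcomp G (conj c) hF.analytic_right
  have hdec : IsCanonicalDecomposition (normalizedTranslate F H α) A B := by
    refine ⟨fun w hw => (hAd w hw).differentiableAt.differentiableWithinAt,
      fun w hw => (hBd w hw).differentiableAt.differentiableWithinAt, fun w hw => ?_⟩
    rw [normalizedTranslate, ← hc, hF.eqOn _ (hmem w hw), hF.eqOn _ hα]
    simp only [hA, hB, map_div₀, map_sub, Complex.conj_conj]
    ring
  refine ⟨A, B, ⟨hdec, ?_, ?_, ?_, ?_, ?_⟩, ?_⟩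
  · intro w hw v hv hwv
    simp only [normalizedTranslate, ← hc] at hwv
    exact diskAut_injOn hα hw hv (hinj (hmem w hw) (hmem v hv)
      (sub_left_injective ((div_left_inj' hc0).1 hwv)))
  · intro w hw
    have h1 := hF.norm_deriv_lt hs (hmem w hw)
    have h2 : 0 < ‖φ' w‖ := norm_pos_iff.2 (hφ'ne w hw)
    have h3 : 0 < ‖c‖ := norm_pos_iff.2 hc0
    have h4 : ‖deriv B w‖ < ‖deriv A w‖ := by
      rw [(hAd w hw).deriv, (hBd w hw).deriv, norm_div, norm_div, norm_mul, norm_mul,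
        RCLike.norm_conj]
      gcongr
    rw [hdec.jacobian_eq hw]
    have h5 : ‖deriv B w‖ ^ 2 < ‖deriv A w‖ ^ 2 := by gcongr
    linarith
  · simp [taylorCoeff, hA, diskAut_zero]
  · rw [taylorCoeff, iteratedDeriv_one, (hAd 0 zero_mem_disk).deriv]
    simp only [hφ', diskAut_zero, mul_zero, add_zero, one_pow, div_one, Nat.factorial_one,
      Nat.cast_one, hc]
    rw [mul_comm, div_self hc0]
  · simp [taylorCoeff, hB, diskAut_zero]
  · have hlin : HasDerivAt (fun w => 1 + conj α * w) (conj α) 0 := by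
      simpa using ((hasDerivAt_id (0 : ℂ)).const_mul (conj α)).const_add 1
    have hev : deriv A =ᶠ[nhds 0] fun w =>
        Complex.exp (h (diskAut α w)) / (deriv H α * (1 + conj α * w) ^ 2) := by
      filter_upwards [isOpen_disk.mem_nhds zero_mem_disk] with w hw
      rw [(hAd w hw).deriv, hh.2 _ (hmem w hw), hφ', hc]
      have := one_add_conj_mul_ne_zero hα hw
      have := hHne α hα
      field_simp
    have hd0 : HasDerivAt (diskAut α) (1 - (‖α‖ : ℂ) ^ 2) 0 := by
      simpa using hasDerivAt_diskAut hα zero_mem_disk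
    have hh0 : HasDerivAt h (deriv h α) (diskAut α 0) := by
      rw [diskAut_zero]; exact hasDerivAt_of_differentiableOn_disk hh.1 hα
    have hq := ((hh0.comp (0 : ℂ) hd0).cexp).div ((hlin.pow 2).const_mul (deriv H α))
      (by simpa using hHne α hα)
    -- Since `A'(0) = 1`, `2a₂` is the logarithmic derivative of `A'` at `0`: the chain rule gives
    -- `(1 - |α|²) h'(α)`, and the factor `(1 + conj α w)⁻²` gives `-2 conj α`.
    have h2 : taylorCoeff A 2 = ((1 - (‖α‖ : ℂ) ^ 2) * deriv h α) / 2 - conj α := by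
      rw [taylorCoeff, iteratedDeriv_succ, iteratedDeriv_one, hev.deriv_eq]
      refine (congrArg (· / ((Nat.factorial 2 : ℕ) : ℂ)) hq.deriv).trans ?_
      simp only [Function.comp_apply, diskAut_zero, hh.2 α hα, mul_zero, add_zero, one_pow,
        Pi.pow_apply]
      have := hHne α hα
      norm_num
      field_simp
    rw [h2, sub_add_cancel, norm_div, norm_mul, hαC, Complex.norm_real,
      Real.norm_of_nonneg hαpos.le, RCLike.norm_ofNat]
    ring

end HarmonicBloch

/-! ### The main theorem. -/

theorem mainTheorem1 (F H G : ℂ → ℂ)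
    (hF : HarmonicBloch.IsCanonicalDecomposition F H G)
    (hF_univ : HarmonicBloch.Univalent F)
    (hF_sense : HarmonicBloch.SensePreserving F) :
    (∃ h : ℂ → ℂ, HarmonicBloch.IsLogOfDeriv h H) ∧
    ∀ h : ℂ → ℂ, HarmonicBloch.IsLogOfDeriv h H →
      (∀ ω : ℂ → ℂ, HarmonicBloch.IsAnalyticSelfMap ω →
        (∃ f g : ℂ → ℂ, HarmonicBloch.IsCanonicalDecomposition f h g ∧
          HarmonicBloch.HasDilatation h g ω) ∧
        ∀ f g : ℂ → ℂ, HarmonicBloch.IsCanonicalDecomposition f h g →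
          HarmonicBloch.HasDilatation h g ω →
          HarmonicBloch.IsBlochType f ∧ HarmonicBloch.beta f < 101) ∧
      ∀ α ∈ HarmonicBloch.disk,
        (∃ A B : ℂ → ℂ,
          HarmonicBloch.MemSHWithParts (HarmonicBloch.normalizedTranslate F H α) A B ∧
          (1 - ‖α‖ ^ 2) * ‖deriv h α‖ = 2 * ‖HarmonicBloch.taylorCoeff A 2 + conj α‖) ∧
        (1 - ‖α‖ ^ 2) * ‖deriv h α‖ < 101 := by
  refine ⟨HarmonicBloch.exists_isLogOfDeriv hF.analytic_left fun z hz =>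
    norm_pos_iff.1 ((norm_nonneg _).trans_lt (hF.norm_deriv_lt hF_sense hz)), fun h hh => ?_⟩
  have hbound : ∀ z ∈ HarmonicBloch.disk, (1 - ‖z‖ ^ 2) * ‖deriv h z‖ ≤ 100.9 := fun z hz =>
    HarmonicBloch.bloch_bound hF hF_univ hF_sense hh hz
  refine ⟨fun ω hω => ⟨HarmonicBloch.exists_coanalytic_part hh.1 hω, fun f g hf hg => ?_⟩,
    fun α hα => ⟨HarmonicBloch.exists_memSHWithParts_normalizedTranslate hF hF_univ hF_sense hh hα,
      (hbound α hα).trans_lt (by norm_num)⟩⟩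
  -- A pointwise strict bound would not pass to the supremum; the margin between `100.9` and `101`
  -- keeps it strict.
  have hlt : HarmonicBloch.beta f < 101 := by
    refine (HarmonicBloch.beta_le hf hω hg hbound).trans_lt ?_
    rw [show (101 : ENNReal) = ENNReal.ofReal 101 by norm_num,
      ENNReal.ofReal_lt_ofReal_iff (by norm_num)]
    norm_num
  exact ⟨⟨hf.harmonicOnNhd, hlt.trans (by norm_num)⟩, hlt⟩
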